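/- Setting. Let $X_1,\dots,X_n$ be independent random variables, $X_i$ having range $D_i$ (a measurable space) and law $\mu_i$, and let $\mu=\mu_1\otimes\dots\otimes\mu_n$. Let $A_1,\dots,A_m$ be (measurable) bad events in $\prod_i D_i$, where membership in $A_k$ depends only on the variables with index in $\mathrm{vbl}(A_k)\subseteq\{1,\dots,n\}$. The dependency graph joins $k\ne l$ when $\mathrm{vbl}(A_k)\cap\mathrm{vbl}(A_l)\neq\emptyset$. The instance is *extremal* if $\mu(A_k\cap A_l)=0$ whenever $k$ and $l$ are adjacent. Let $S$ be the set of assignments that lie in no $A_k$. Algorithms. *Parallel partial rejection sampling*: draw all variables independently from their laws; while some bad event occurs, let $I$ be the set of all occurring events and independently resample all variables in $\bigcup_{k\in I}\mathrm{vbl}(A_k)$; output the current assignment. The *(sequential) Moser–Tardos algorithm*: draw all variables independently; while some bad event occurs, pick one of the occurring events $A_k$ uniformly at random and independently resample the variables in $\mathrm{vbl}(A_k)$; output the current assignment. Theorem. (1) Suppose that the instance is extremal. If parallel partial rejection sampling halts with positive probability, then $\mu(S)>0$ and, conditioned on halting, its output has the law $\mu(\,\cdot\mid S)$, the product distribution conditioned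 on avoiding all bad events. The same holds for the Moser–Tardos algorithm. (2) (Sink-popping.) Let $G$ be a finite simple graph. Take one variable for each edge, its uniformly random orientation, and for each vertex $v$ the bad event that $v$ is a sink (all edges at $v$ point towards $v$), which depends on the edges at $v$. This instance is extremal, the assignments avoiding all bad events are the sink-free orientations, and parallel partial rejection sampling on it is the sink-popping algorithm: orient all edges uniformly at random and, while there is a sink, re-orient at random all edges incident to sinks. If this algorithm halts with positive probability then, conditioned on halting, its output is a uniformly random sink-free orientation of $G$. (3) (Wilson's cycle-popping.) Let $G$ be a finite simple graph and $r$ a vertex such that every vertex other than $r$ has a neighbour. Take one variable for each vertex $v\neq r$, an arrow from $v$ to a uniformly random neighbour of $v$, and for each directed cycle of $G$ avoiding $r$ (of length at least $2$) the bad event that all its arrows are present, which depends on the vertices of the cycle. This instance is extremal, the assignments avoiding all bad events are the directed spanning trees with root $r$ (the arrows lead from every vertex to $r$), and parallel partial rejection sampling on it is the cycle-popping algorithm: draw all arrows and, while there is a directed cycle, redraw the arrows of all vertices on directed cycles. If this algorithm halts with positive probability then, conditioned on halting, its output is a uniformly random directed spanning tree of $G$ with root $r$. -/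

import Mathlib

open MeasureTheory ProbabilityTheory

universe u v w z

noncomputable section

namespace PRS

/-- The variable framework: independent variables indexed by `ι`, the `i`-th one having range `D i`
and law `law i`, and bad events indexed by `κ`.  `vbl k` is the index set of the variables that
the event `bad k` depends on. -/
structure Framework (ι : Type u) (κ : Type v) (D : ι → Type w) [∀ i, MeasurableSpace (D i)] where
  law : ∀ i, Measure (D i)
  isProbabilityMeasure_law : ∀ i, IsProbabilityMeasure (law i)
  bad : κ → Set (∀ i, D i)
  measurableSet_bad : ∀ k, MeasurableSet (bad k)
  vbl : κ → Set ι
  dependsOn_vbl : ∀ k, DependsOn (fun σ => σ ∈ bad k) (vbl k)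

/-- The result of resampling the variables in `R`: they take the values of `x`, and all other
variables keep the values of `σ`. -/
def resample {ι : Type u} {D : ι → Type w} (R : Set ι) (x σ : ∀ i, D i) : ∀ i, D i :=
  open Classical in fun i => if i ∈ R then x i else σ i

/-- A rule that picks an element from every nonempty set of events. -/
abbrev Picker (κ : Type v) : Type v := ∀ S : {S : Set κ // S.Nonempty}, {k : κ // k ∈ S.1}

namespace Framework

variable {ι : Type u} {κ : Type v} {D : ι → Type w} [∀ i, MeasurableSpace (D i)]

/-- The product distribution of the variables. -/
def prod [Fintype ι] (F : Framework ι κ D) : Measure (∀ i, D i) := Measure.pi F.law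

/-- The dependency graph: two distinct events are adjacent if they have a common variable. -/
def dependencyGraph (F : Framework ι κ D) : SimpleGraph κ where
  Adj k l := k ≠ l ∧ (F.vbl k ∩ F.vbl l).Nonempty
  symm := ⟨fun _ _ h => ⟨h.1.symm, by rw [Set.inter_comm]; exact h.2⟩⟩
  loopless := ⟨fun _ h => h.1 rfl⟩

/-- Any two dependent events are disjoint, up to probability zero. -/
def Extremal [Fintype ι] (F : Framework ι κ D) : Prop :=
  ∀ k l, F.dependencyGraph.Adj k l → F.prod (F.bad k ∩ F.bad l) = 0

/-- The set of bad events that occur under the assignment `σ`. -/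
def occurring (F : Framework ι κ D) (σ : ∀ i, D i) : Set κ := {k | σ ∈ F.bad k}

/-- The assignments that avoid all bad events. -/
def good (F : Framework ι κ D) : Set (∀ i, D i) := {σ | F.occurring σ = ∅}

/-- The successive assignments of parallel partial rejection sampling, when `x 0` is the initial
draw of all variables and `x (t + 1)` supplies the fresh values for the `t + 1`-st resampling:
all variables of all occurring bad events are resampled at once. -/
def parallelRun (F : Framework ι κ D) (x : ℕ → ∀ i, D i) : ℕ → ∀ i, D i
  | 0 => x 0
  | t + 1 => resample (⋃ k ∈ F.occurring (parallelRun F x t), F.vbl k) (x (t + 1))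
      (parallelRun F x t)

/-- The successive assignments of the sequential Moser-Tardos algorithm: while some bad event
occurs, one of the occurring events is picked by means of `c (t + 1)`, and its variables are
resampled with the fresh values `x (t + 1)`. -/
def sequentialRun (F : Framework ι κ D) (x : ℕ → ∀ i, D i) (c : ℕ → Picker κ) : ℕ → ∀ i, D i
  | 0 => x 0
  | t + 1 =>
    open Classical in
    if h : (F.occurring (sequentialRun F x c t)).Nonempty then
      resample (F.vbl (c (t + 1) ⟨_, h⟩).1) (x (t + 1)) (sequentialRun F x c t)
    else sequentialRun F x c t

/-- A run halts if at some time no bad event occurs. -/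
def Halts (F : Framework ι κ D) (run : ℕ → ∀ i, D i) : Prop := ∃ t, run t ∈ F.good

/-- The output of a run: its assignment at the first time at which no bad event occurs
(of no significance if the run does not halt). -/
def output (F : Framework ι κ D) (run : ℕ → ∀ i, D i) : ∀ i, D i :=
  run (sInf {t | run t ∈ F.good})

end Framework

/-- The `x t`, for `t = 0, 1, 2, …`, are independent draws of all variables of `F`. -/
structure FreshDraws {ι : Type u} {κ : Type v} {D : ι → Type w} [∀ i, MeasurableSpace (D i)]
    [Fintype ι] (F : Framework ι κ D) {Ω : Type*} [MeasurableSpace Ω] (P : Measure Ω)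
    (x : ℕ → Ω → ∀ i, D i) : Prop where
  measurable : ∀ t, Measurable (x t)
  map_eq : ∀ t, P.map (x t) = F.prod
  indep : iIndepFun x P

/-- Independent draws `x t` of all variables of `F`, together with rules `c t`, independent of
each other and of the draws, that pick from each nonempty set of events uniformly at random. -/
structure FreshDrawsAndPicks {ι : Type u} {κ : Type v} {D : ι → Type w}
    [∀ i, MeasurableSpace (D i)] [MeasurableSpace κ] [Fintype ι] (F : Framework ι κ D)
    {Ω : Type*} [MeasurableSpace Ω] (P : Measure Ω)
    (x : ℕ → Ω → ∀ i, D i) (c : ℕ → Ω → Picker κ) : Prop where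
  measurable_draw : ∀ t, Measurable (x t)
  measurable_pick : ∀ t, Measurable (c t)
  map_eq : ∀ t, P.map (x t) = F.prod
  uniform : ∀ t (S : {S : Set κ // S.Nonempty}) (k : {k : κ // k ∈ S.1}),
    P {ω | c t ω S = k} = (S.1.ncard : ENNReal)⁻¹
  indep_draw_pick : ∀ t, IndepFun (x t) (c t) P
  indep : iIndepFun (fun t ω => (x t ω, c t ω)) P

/-! ### Sink popping -/

/-- The two orientations of the edge `e`. -/
def EdgeOrientation {V : Type u} (G : SimpleGraph V) (e : G.edgeSet) : Type u :=
  {d : G.Dart // d.edge = e}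

instance {V : Type u} (G : SimpleGraph V) (e : G.edgeSet) :
    MeasurableSpace (EdgeOrientation G e) := ⊤

/-- An orientation of the graph `G`. -/
abbrev Orientation {V : Type u} (G : SimpleGraph V) : Type u := ∀ e, EdgeOrientation G e

/-- All edges at `a` point towards `a`. -/
def IsSink {V : Type u} {G : SimpleGraph V} (σ : Orientation G) (a : V) : Prop :=
  ∀ e : G.edgeSet, a ∈ (e : Sym2 V) → (σ e).1.snd = a

/-- The sink-popping algorithm: while there is a sink, re-orient all edges at sinks. -/
def sinkPopping {V : Type u} {G : SimpleGraph V} (x : ℕ → Orientation G) : ℕ → Orientation G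
  | 0 => x 0
  | t + 1 => open Classical in fun e =>
    if ∃ a ∈ (e : Sym2 V), IsSink (sinkPopping x t) a then x (t + 1) e else sinkPopping x t e

instance {V : Type u} [Finite V] (G : SimpleGraph V) (e : G.edgeSet) :
    Finite (EdgeOrientation G e) := by
  have : Function.Injective (fun d : EdgeOrientation G e => d.1.toProd) := fun a b h =>
    Subtype.ext (SimpleGraph.Dart.ext _ _ h)
  exact Finite.of_injective _ this

instance {V : Type u} (G : SimpleGraph V) (e : G.edgeSet) :
    Nonempty (EdgeOrientation G e) := by
  obtain ⟨e, he⟩ := e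
  induction e using Sym2.ind with
  | _ a b => exact ⟨⟨⟨(a, b), he⟩, rfl⟩⟩

/-- The edges are oriented uniformly at random; the bad event of a vertex is that it is a sink. -/
def sinkFramework {V : Type u} [Finite V] (G : SimpleGraph V) :
    Framework G.edgeSet V (EdgeOrientation G) where
  law _ := uniformOn Set.univ
  isProbabilityMeasure_law _ := isProbabilityMeasure_uniformOn Set.finite_univ Set.univ_nonempty
  bad a := {σ | IsSink σ a}
  measurableSet_bad a := (Set.toFinite _).measurableSet
  vbl a := {e | a ∈ (e : Sym2 V)}
  dependsOn_vbl a σ τ h := by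
    refine propext (forall₂_congr fun e he => ?_)
    rw [h e he]

/-! ### Cycle popping -/

/-- The possible successors of the vertex `a`. -/
def Arrow {V : Type u} (G : SimpleGraph V) (a : V) : Type u := {b : V // G.Adj a b}

instance {V : Type u} (G : SimpleGraph V) (a : V) : MeasurableSpace (Arrow G a) := ⊤

instance {V : Type u} [Finite V] (G : SimpleGraph V) (a : V) : Finite (Arrow G a) :=
  inferInstanceAs (Finite {b : V // G.Adj a b})

/-- A choice of an arrow from every vertex other than `r` to one of its neighbours. -/
abbrev Arrows {V : Type u} (G : SimpleGraph V) (r : V) : Type u :=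
  ∀ a : {a : V // a ≠ r}, Arrow G a.1

/-- Follow the arrow at a vertex; the walk stays at `r` once it is there. -/
def next {V : Type u} {G : SimpleGraph V} {r : V} (s : Arrows G r) (a : V) : V :=
  open Classical in if h : a = r then r else (s ⟨a, h⟩).1

/-- The arrows form a directed spanning tree with root `r`: they lead from every vertex to `r`. -/
def IsRootedTree {V : Type u} {G : SimpleGraph V} {r : V} (s : Arrows G r) : Prop :=
  ∀ a, ∃ n : ℕ, (next s)^[n] a = r

/-- The cycle-popping algorithm: while there is a directed cycle, redraw the arrows of all
vertices that lie on directed cycles. -/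
def cyclePopping {V : Type u} {G : SimpleGraph V} {r : V} (x : ℕ → Arrows G r) : ℕ → Arrows G r
  | 0 => x 0
  | t + 1 => open Classical in fun a =>
    if a.1 ∈ Function.periodicPts (next (cyclePopping x t)) then x (t + 1) a
    else cyclePopping x t a

/-- The directed cycles of `G` that avoid `r`, each as the cyclic permutation of its vertices that
moves every vertex to the next one. Cycles have length at least two. -/
def DirectedCycle {V : Type u} (G : SimpleGraph V) (r : V) : Type u :=
  {p : Equiv.Perm V // p.IsCycle ∧ p r = r ∧ ∀ a, p a ≠ a → G.Adj a (p a)}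

/-- Every vertex other than `r` has an arrow to a uniformly random neighbour; the bad event of a
directed cycle is that all arrows of the cycle are present. -/
def cycleFramework {V : Type u} [Finite V] (G : SimpleGraph V) (r : V)
    (h : ∀ a, a ≠ r → ∃ b, G.Adj a b) :
    Framework {a : V // a ≠ r} (DirectedCycle G r) (fun a => Arrow G a.1) where
  law _ := uniformOn Set.univ
  isProbabilityMeasure_law a :=
    have : Nonempty (Arrow G a.1) := (h a.1 a.2).elim fun b hb => ⟨⟨b, hb⟩⟩
    isProbabilityMeasure_uniformOn Set.finite_univ Set.univ_nonempty
  bad p := {s | ∀ a : {a : V // a ≠ r}, p.1 a.1 ≠ a.1 → (s a).1 = p.1 a.1}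
  measurableSet_bad p := (Set.toFinite _).measurableSet
  vbl p := {a | p.1 a.1 ≠ a.1}
  dependsOn_vbl p s s' h := by
    refine propext (forall₂_congr fun a ha => ?_)
    rw [h a ha]

end PRS

end

/-! The invariant is `IsWeighted`: conditioned on the set of occurring bad events, the current
assignment is distributed as under the product measure. The initial draw has it. At the empty set of
events it says that the halted part of the law is a multiple of the product measure restricted to
`good`.

Each resampling preserves it. Let `T` be the occurring set and `R ⊆ T` the events whose variables
are redrawn. Extremality excludes, almost surely, any neighbour of `R` outside `R`. So `T` occurs
exactly when every event of `R` occurs, a condition on the variables of `R`, and the events away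
from `R` that occur are those of `T \ R`, a condition on the other variables. Redrawing the former
forgets the first condition and keeps the second, which the new occurring set determines. This is
`Extremal.exists_prod_resample`, resting on the exchange of coordinates in
`prod_resample_mem_inter`; `IsWeighted.map_step` sums over `T` and `R`.

The parallel run takes `R = T`, the sequential run a singleton. Good assignments are never changed,
so the halted parts increase in time, and `hasLaw_output_of_isWeighted` passes to the limit. Sink
and cycle popping are extremal because dependent bad events are disjoint. -/

noncomputable section

namespace PRS

/-! ### Exchanging coordinates between independent product samples -/

section Resample

variable {ι : Type u} {D : ι → Type w}

theorem resample_apply_of_mem {R : Set ι} {i : ι} (h : i ∈ R) (x σ : ∀ i, D i) :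
    resample R x σ i = x i := if_pos h

theorem resample_apply_of_notMem {R : Set ι} {i : ι} (h : i ∉ R) (x σ : ∀ i, D i) :
    resample R x σ i = σ i := if_neg h

theorem resample_empty (x σ : ∀ i, D i) : resample ∅ x σ = σ :=
  funext fun _ => resample_apply_of_notMem (Set.notMem_empty _) _ _

variable [∀ i, MeasurableSpace (D i)]

theorem measurable_resample (R : Set ι) :
    Measurable fun p : (∀ i, D i) × (∀ i, D i) => resample R p.2 p.1 := by
  refine measurable_pi_lambda _ fun i => ?_
  by_cases h : i ∈ R
  · simp only [resample_apply_of_mem h]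
    fun_prop
  · simp only [resample_apply_of_notMem h]
    fun_prop

/-- Exchanging the coordinates in `R` between two independent samples of a product measure yields
two independent samples again. -/
theorem measurePreserving_resample_prodMk [Fintype ι] (μ : ∀ i, Measure (D i))
    [∀ i, IsProbabilityMeasure (μ i)] (R : Set ι) :
    MeasurePreserving
      (fun p : (∀ i, D i) × (∀ i, D i) => (resample R p.2 p.1, resample R p.1 p.2))
      ((Measure.pi μ).prod (Measure.pi μ)) ((Measure.pi μ).prod (Measure.pi μ)) := by
  classical
  have hm : Measurable
      (fun p : (∀ i, D i) × (∀ i, D i) => (resample R p.2 p.1, resample R p.1 p.2)) :=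
    (measurable_resample R).prodMk ((measurable_resample R).comp measurable_swap)
  refine ⟨hm, (Measure.prod_eq_generateFrom generateFrom_pi generateFrom_pi isPiSystem_pi
    isPiSystem_pi ⟨fun _ => Set.univ, ?_, ?_, ?_⟩ ⟨fun _ => Set.univ, ?_, ?_, ?_⟩ ?_).symm⟩
  · exact fun _ => ⟨fun _ => Set.univ, by simp, by simp⟩
  · simp
  · simp [Set.iUnion_const]
  · exact fun _ => ⟨fun _ => Set.univ, by simp, by simp⟩
  · simp
  · simp [Set.iUnion_const]
  rintro _ ⟨s, hs, rfl⟩ _ ⟨t, ht, rfl⟩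
  have hs' : ∀ i, MeasurableSet (s i) := fun i => hs i trivial
  have ht' : ∀ i, MeasurableSet (t i) := fun i => ht i trivial
  -- The exchange pulls a pair of boxes back to a pair of boxes with the sides in `R` swapped, so
  -- the product of all side measures is unchanged.
  have key : (fun p : (∀ i, D i) × (∀ i, D i) => (resample R p.2 p.1, resample R p.1 p.2)) ⁻¹'
      (Set.univ.pi s ×ˢ Set.univ.pi t) =
      (Set.univ.pi fun i => if i ∈ R then t i else s i) ×ˢ
        (Set.univ.pi fun i => if i ∈ R then s i else t i) := by
    ext ⟨x, y⟩
    simp only [Set.mem_preimage, Set.mem_prod, Set.mem_univ_pi, ← forall_and]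
    refine forall_congr' fun i => ?_
    by_cases h : i ∈ R
    · simp only [resample_apply_of_mem h, if_pos h, and_comm]
    · simp only [resample_apply_of_notMem h, if_neg h]
  rw [Measure.map_apply hm ((MeasurableSet.univ_pi hs').prod (MeasurableSet.univ_pi ht')), key,
    Measure.prod_prod, Measure.pi_pi, Measure.pi_pi, Measure.pi_pi, Measure.pi_pi,
    ← Finset.prod_mul_distrib, ← Finset.prod_mul_distrib]
  refine Finset.prod_congr rfl fun i _ => ?_
  by_cases h : i ∈ R
  · simp only [if_pos h, mul_comm]
  · simp only [if_neg h]

/-- If `A` depends on the coordinates in `R` and `B` on the others, then resampling the coordinates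
in `R` conditionally on `A ∩ B` forgets `A` and retains `B`. -/
theorem prod_resample_mem_inter [Fintype ι] (μ : ∀ i, Measure (D i))
    [∀ i, IsProbabilityMeasure (μ i)] (R : Set ι) {A B C : Set (∀ i, D i)}
    (hA : MeasurableSet A) (hB : MeasurableSet B) (hC : MeasurableSet C)
    (hAR : DependsOn (· ∈ A) R) (hBR : DependsOn (· ∈ B) Rᶜ) :
    (Measure.pi μ).prod (Measure.pi μ) {p | p.1 ∈ A ∩ B ∧ resample R p.2 p.1 ∈ C} =
      Measure.pi μ A * Measure.pi μ (B ∩ C) := by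
  -- After the exchange the first component is the resampled assignment. The second carries the old
  -- values on `R`, so `A` can be tested there.
  have h := (measurePreserving_resample_prodMk μ R).measure_preimage
    ((hB.inter hC).prod hA).nullMeasurableSet
  rw [Measure.prod_prod] at h
  rw [mul_comm, ← h]
  congr 1
  ext ⟨σ, x⟩
  have h1 : (σ ∈ A) = (resample R σ x ∈ A) :=
    hAR fun i hi => (resample_apply_of_mem hi σ x).symm
  have h2 : (σ ∈ B) = (resample R x σ ∈ B) :=
    hBR fun i hi => (resample_apply_of_notMem hi x σ).symm
  simp only [Set.mem_ofPred_eq, Set.mem_inter_iff, Set.mem_preimage, Set.mem_prod, ← h1, ← h2]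
  tauto

end Resample

/-! ### One resampling of an extremal instance -/

namespace Framework

variable {ι : Type u} {κ : Type v} {D : ι → Type w} [∀ i, MeasurableSpace (D i)]
  (F : Framework ι κ D)

/-- The variables that the events in `R` depend on. -/
def vars (R : Set κ) : Set ι := ⋃ k ∈ R, F.vbl k

/-- The events in `R` and those that have a common variable with an event in `R`. -/
def closedNeighbors (R : Set κ) : Set κ := R ∪ {k | ¬ Disjoint (F.vbl k) (F.vars R)}

theorem vbl_subset_vars {R : Set κ} {k : κ} (hk : k ∈ R) : F.vbl k ⊆ F.vars R :=
  Set.subset_biUnion_of_mem (u := fun k => F.vbl k) hk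

theorem measurableSet_occurring [Countable κ] (S : Set (Set κ)) (hS : S.Countable) :
    MeasurableSet {σ | F.occurring σ ∈ S} := by
  have h (T : Set κ) : MeasurableSet {σ | F.occurring σ = T} := by
    have : {σ | F.occurring σ = T} = ⋂ k, {σ | σ ∈ F.bad k ↔ k ∈ T} := by
      ext σ
      simp [Set.ext_iff, occurring]
    rw [this]
    refine MeasurableSet.iInter fun k => ?_
    by_cases hk : k ∈ T
    · simpa [hk] using F.measurableSet_bad k
    · simp only [hk, iff_false]
      exact (F.measurableSet_bad k).compl
  have : {σ | F.occurring σ ∈ S} = ⋃ T ∈ S, {σ | F.occurring σ = T} := by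
    ext; simp
  rw [this]
  exact MeasurableSet.biUnion hS fun T _ => h T

theorem measurableSet_occurring_eq [Countable κ] (T : Set κ) :
    MeasurableSet {σ | F.occurring σ = T} := by
  simpa using F.measurableSet_occurring {T} (Set.countable_singleton T)

theorem measurableSet_good [Countable κ] : MeasurableSet F.good :=
  F.measurableSet_occurring_eq ∅

instance [Fintype ι] : IsProbabilityMeasure F.prod :=
  have := F.isProbabilityMeasure_law
  inferInstanceAs (IsProbabilityMeasure (Measure.pi F.law))

variable {F}

/-- For an extremal instance, resampling the variables of some events `R ⊆ T` conditionally on `T`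
being the set of occurring events yields the product distribution conditioned on a set of
assignments that is determined by the occurring events. -/
theorem Extremal.exists_prod_resample [Fintype ι] [Finite κ] (hF : F.Extremal)
    {R T : Set κ} (hRT : R ⊆ T) (T' : Set κ) :
    ∃ a : ENNReal, ∀ C, MeasurableSet C → C ⊆ {σ | F.occurring σ = T'} →
      F.prod.prod F.prod {p | F.occurring p.1 = T ∧ resample (F.vars R) p.2 p.1 ∈ C} =
        a * F.prod C := by
  have hprob := F.isProbabilityMeasure_law
  -- Off this null set the occurring events are pairwise non-adjacent.
  set N : Set (∀ i, D i) := ⋃ k, ⋃ l, ⋃ _ : F.dependencyGraph.Adj k l, F.bad k ∩ F.bad l with hN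
  have hN0 : F.prod N = 0 := by
    simp only [hN, measure_iUnion_null_iff]
    exact hF
  have hNadj {σ} (hσ : σ ∉ N) {k l} (hk : k ∈ F.occurring σ) (hl : l ∈ F.occurring σ) :
      ¬ F.dependencyGraph.Adj k l := fun h => hσ <| by
    simp only [hN, Set.mem_iUnion]
    exact ⟨k, l, h, hk, hl⟩
  have hind {σ} (hσ : σ ∉ N) (hRσ : R ⊆ F.occurring σ) :
      F.occurring σ ∩ F.closedNeighbors R = R := by
    refine Set.Subset.antisymm ?_ fun k hk => ⟨hRσ hk, Or.inl hk⟩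
    rintro k ⟨hk, hkR | hkR⟩
    · exact hkR
    · by_contra hkR'
      obtain ⟨i, hi, hiR⟩ := Set.not_disjoint_iff.1 hkR
      obtain ⟨l, hl, hil⟩ := Set.mem_iUnion₂.1 hiR
      exact hNadj hσ hk (hRσ hl) ⟨fun h => hkR' (h ▸ hl), i, hi, hil⟩
  have hN0' : F.prod.prod F.prod (Prod.fst ⁻¹' N) = 0 := by
    rw [← Set.prod_univ, Measure.prod_prod, hN0, zero_mul]
  -- If `T` contains a neighbour of `R` outside `R`, then `T` is almost surely not the occurring set
  -- and the weight is zero.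
  by_cases hT : T ∩ F.closedNeighbors R = R
  swap
  · refine ⟨0, fun C _ _ => ?_⟩
    rw [zero_mul]
    refine measure_mono_null (fun p hp => ?_) hN0'
    by_contra hpN
    exact hT (hp.1 ▸ hind hpN (hp.1.symm ▸ hRT))
  set A : Set (∀ i, D i) := ⋂ k ∈ R, F.bad k with hA
  set B : Set (∀ i, D i) := {σ | F.occurring σ \ F.closedNeighbors R = T \ R} with hB
  have hAm : MeasurableSet A :=
    MeasurableSet.biInter (Set.to_countable R) fun k _ => F.measurableSet_bad k
  have hBm : MeasurableSet B :=
    F.measurableSet_occurring {S | S \ F.closedNeighbors R = T \ R} (Set.to_countable _)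
  have hAR : DependsOn (· ∈ A) (F.vars R) := fun σ τ h => by
    simp only [hA, Set.mem_iInter]
    exact propext (forall₂_congr fun k hk =>
      iff_of_eq (F.dependsOn_vbl k fun i hi => h i (F.vbl_subset_vars hk hi)))
  have hBR : DependsOn (· ∈ B) (F.vars R)ᶜ := fun σ τ h => by
    have : F.occurring σ \ F.closedNeighbors R = F.occurring τ \ F.closedNeighbors R := by
      ext k
      refine and_congr_left fun hk => ?_
      have hk' : Disjoint (F.vbl k) (F.vars R) := not_not.1 fun h => hk (Or.inr h)
      exact iff_of_eq (F.dependsOn_vbl k fun i hi => h i (Set.disjoint_left.1 hk' hi))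
    simp only [hB, Set.mem_ofPred_eq, this]
  have hAB {σ} (hσ : σ ∉ N) : F.occurring σ = T ↔ σ ∈ A ∩ B := by
    have hAσ : σ ∈ A ↔ R ⊆ F.occurring σ := by
      simp only [hA, Set.mem_iInter]
      rfl
    rw [Set.mem_inter_iff, hAσ]
    have hTd : T \ F.closedNeighbors R = T \ R := by
      rw [← Set.sdiff_self_inter, hT]
    constructor
    · rintro rfl
      exact ⟨hRT, hTd⟩
    · rintro ⟨h1, h2⟩
      have h2 : F.occurring σ \ F.closedNeighbors R = T \ R := h2
      rw [← Set.inter_union_sdiff (F.occurring σ) (F.closedNeighbors R), hind hσ h1, h2,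
        Set.union_sdiff_cancel hRT]
  have hC' (C) (hC : MeasurableSet C) :
      F.prod.prod F.prod {p | F.occurring p.1 = T ∧ resample (F.vars R) p.2 p.1 ∈ C} =
        F.prod A * F.prod (B ∩ C) := by
    refine Eq.trans (measure_congr ?_) (prod_resample_mem_inter F.law (F.vars R) hAm hBm hC hAR hBR)
    filter_upwards [measure_eq_zero_iff_ae_notMem.1 hN0'] with p hp
    exact propext (and_congr_left fun _ => hAB hp)
  -- Membership in `B` depends only on the occurring set, so the assignments with occurring set `T'`
  -- lie all inside `B` or all outside it.
  by_cases hT' : T' \ F.closedNeighbors R = T \ R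
  · refine ⟨F.prod A, fun C hC hCT => ?_⟩
    rw [hC' C hC, Set.inter_eq_right.2 fun σ hσ => ?_]
    rw [hB, Set.mem_ofPred_eq, hCT hσ, hT']
  · refine ⟨0, fun C hC hCT => ?_⟩
    rw [hC' C hC, (Set.disjoint_left.2 fun σ hσ hσ' => ?_ : Disjoint B C).inter_eq]
    · simp
    · have h1 : F.occurring σ = T' := hCT hσ'
      exact hT' (h1 ▸ hσ)

end Framework

/-- The state at time `t` of a recursion driven by independent inputs is independent of the next
input. -/
theorem indepFun_recursion {Ω S E : Type*} [MeasurableSpace Ω] [MeasurableSpace S]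
    [MeasurableSpace E] {P : Measure Ω} {z : ℕ → Ω → E} (hz : ∀ t, Measurable (z t))
    (hind : iIndepFun z P) {Y : ℕ → Ω → S} {g₀ : E → S} {g : S × E → S} (hg₀ : Measurable g₀)
    (hg : Measurable g) (hY₀ : ∀ ω, Y 0 ω = g₀ (z 0 ω))
    (hY : ∀ t ω, Y (t + 1) ω = g (Y t ω, z (t + 1) ω)) (t : ℕ) :
    Measurable (Y t) ∧ IndepFun (Y t) (z (t + 1)) P := by
  -- The state at time `t` is a function of the inputs up to time `t`, a block disjoint from `{t +
  -- 1}`.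
  have key : ∃ φ : (Finset.range (t + 1) → E) → S, Measurable φ ∧
      ∀ ω, Y t ω = φ fun i => z i ω := by
    induction t with
    | zero => exact ⟨fun v => g₀ (v ⟨0, by simp⟩), by fun_prop, hY₀⟩
    | succ t ih =>
      obtain ⟨φ, hφ, h⟩ := ih
      refine ⟨fun v => g (φ fun i => v ⟨i.1, Finset.mem_range.2
        (Nat.lt_succ_of_lt (Finset.mem_range.1 i.2))⟩, v ⟨t + 1, by simp⟩), by fun_prop,
        fun ω => ?_⟩
      rw [hY, h]
  obtain ⟨φ, hφ, h⟩ := key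
  have hY' : Y t = fun ω => φ fun i => z i ω := funext h
  refine ⟨hY' ▸ hφ.comp (measurable_pi_lambda _ fun i => hz i), ?_⟩
  have h1 := hind.indepFun_finset (Finset.range (t + 1)) {t + 1} (by simp) hz
  rw [hY']
  exact h1.comp hφ (measurable_pi_apply (⟨t + 1, by simp⟩ : ({t + 1} : Finset ℕ)))

/-! ### Propagation of weighted laws and the law of the output -/

namespace Framework

variable {ι : Type u} {κ : Type v} {D : ι → Type w} [∀ i, MeasurableSpace (D i)]
  (F : Framework ι κ D)

/-- Resampling with a rule `r` that selects the events whose variables are resampled from the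
occurring events by means of `c`. -/
def step {C : Type*} (r : C → Set κ → Set κ) (σ : ∀ i, D i) (p : (∀ i, D i) × C) : ∀ i, D i :=
  resample (F.vars (r p.2 (F.occurring σ))) p.1 σ

/-- Conditioned on the set of occurring events, `ν` is proportional to the product distribution. -/
def IsWeighted [Fintype ι] (ν : Measure (∀ i, D i)) : Prop :=
  ∀ T, ∃ a : ENNReal, ∀ B, MeasurableSet B → B ⊆ {σ | F.occurring σ = T} → ν B = a * F.prod B

theorem isWeighted_prod [Fintype ι] : F.IsWeighted F.prod :=
  fun _ => ⟨1, fun _ _ _ => (one_mul _).symm⟩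

section Step

variable {C : Type*} {r : C → Set κ → Set κ}

/-- Splitting by the occurring set and the selected set makes the resampled variables constant on
each piece, and separates the assignments from the selection. -/
theorem preimage_step [MeasurableSpace C] (B : Set (∀ i, D i)) :
    (fun q : (∀ i, D i) × ((∀ i, D i) × C) => F.step r q.1 q.2) ⁻¹' B =
      ⋃ S : Set κ × Set κ, MeasurableEquiv.prodAssoc.symm ⁻¹'
        ({p : (∀ i, D i) × (∀ i, D i) |
            F.occurring p.1 = S.1 ∧ resample (F.vars S.2) p.2 p.1 ∈ B} ×ˢ
          {c | r c S.1 = S.2}) := by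
  ext ⟨σ, x, c⟩
  simp only [Set.mem_preimage, Set.mem_iUnion, Set.mem_prod, Set.mem_ofPred_eq, step,
    MeasurableEquiv.prodAssoc, MeasurableEquiv.symm_mk, MeasurableEquiv.coe_mk,
    Equiv.prodAssoc_symm_apply]
  constructor
  · exact fun h => ⟨(F.occurring σ, r c (F.occurring σ)), ⟨rfl, h⟩, rfl⟩
  · rintro ⟨⟨T, R⟩, ⟨rfl, h⟩, hR⟩
    rwa [show r c (F.occurring σ) = R from hR]

theorem measurableSet_occurring_resample [Countable κ] (T R : Set κ) {B : Set (∀ i, D i)}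
    (hB : MeasurableSet B) :
    MeasurableSet {p : (∀ i, D i) × (∀ i, D i) |
      F.occurring p.1 = T ∧ resample (F.vars R) p.2 p.1 ∈ B} :=
  (measurable_fst (F.measurableSet_occurring_eq T)).inter (measurable_resample _ hB)

variable [MeasurableSpace C]

theorem measurable_step [Finite κ] (hr : ∀ T R, MeasurableSet {c | r c T = R}) :
    Measurable fun q : (∀ i, D i) × ((∀ i, D i) × C) => F.step r q.1 q.2 := by
  intro B hB
  rw [preimage_step]
  exact MeasurableSet.iUnion fun S => MeasurableEquiv.prodAssoc.symm.measurable
    ((F.measurableSet_occurring_resample S.1 S.2 hB).prod (hr _ _))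

variable {F}

theorem IsWeighted.map_step [Fintype ι] [Finite κ] (hF : F.Extremal)
    {ν : Measure (∀ i, D i)} [IsFiniteMeasure ν] (hν : F.IsWeighted ν) (l : Measure C)
    [IsFiniteMeasure l] (hr : ∀ T R, MeasurableSet {c | r c T = R}) (hrT : ∀ c T, r c T ⊆ T) :
    F.IsWeighted ((ν.prod (F.prod.prod l)).map fun q => F.step r q.1 q.2) := by
  intro T'
  have h1 (S : Set κ × Set κ) : ∃ a : ENNReal, ∀ B, MeasurableSet B →
      B ⊆ {σ | F.occurring σ = T'} →
      ν.prod F.prod {p | F.occurring p.1 = S.1 ∧ resample (F.vars S.2) p.2 p.1 ∈ B} *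
        l {c | r c S.1 = S.2} = a * F.prod B := by
    by_cases hS : S.2 ⊆ S.1
    · obtain ⟨a, ha⟩ := hF.exists_prod_resample hS T'
      obtain ⟨b, hb⟩ := hν S.1
      refine ⟨b * a * l {c | r c S.1 = S.2}, fun B hB hBT => ?_⟩
      have hm := F.measurableSet_occurring_resample S.1 S.2 hB
      have h2 : ν.prod F.prod {p | F.occurring p.1 = S.1 ∧ resample (F.vars S.2) p.2 p.1 ∈ B} =
          b * F.prod.prod F.prod
            {p | F.occurring p.1 = S.1 ∧ resample (F.vars S.2) p.2 p.1 ∈ B} := by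
        rw [Measure.prod_apply_symm hm, Measure.prod_apply_symm hm,
          ← lintegral_const_mul _ (measurable_measure_prodMk_right hm)]
        -- For fixed fresh values `x`, the slice lies in a single class of occurring sets, where `ν`
        -- is `b` times the product measure.
        refine lintegral_congr fun x => hb _ (measurable_prodMk_right hm) fun σ hσ => hσ.1
      rw [h2, ha B hB hBT]
      ring
    · refine ⟨0, fun B _ _ => ?_⟩
      have : {c | r c S.1 = S.2} = ∅ :=
        Set.eq_empty_of_forall_notMem fun c hc => hS (hc ▸ hrT c S.1)
      simp [this]
  choose a ha using h1
  refine ⟨∑' S, a S, fun B hB hBT => ?_⟩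
  rw [Measure.map_apply (F.measurable_step hr) hB, preimage_step, measure_iUnion,
    ← ENNReal.tsum_mul_right]
  · refine tsum_congr fun S => ?_
    rw [← ha S B hB hBT, ← Measure.prod_prod, ← Measure.prodAssoc_prod,
      Measure.map_apply MeasurableEquiv.prodAssoc.measurable, ← Set.preimage_comp]
    · simp
    · exact MeasurableEquiv.prodAssoc.symm.measurable
        ((F.measurableSet_occurring_resample S.1 S.2 hB).prod (hr _ _))
  · intro S S' hSS'
    refine Set.disjoint_left.2 fun q hq hq' => hSS' ?_
    have e1 : S.1 = S'.1 := hq.1.1.symm.trans hq'.1.1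
    have e2 : S.2 = S'.2 := by
      rw [← show r q.2.2 S.1 = S.2 from hq.2, ← show r q.2.2 S'.1 = S'.2 from hq'.2, e1]
    exact Prod.ext e1 e2
  · exact fun S => MeasurableEquiv.prodAssoc.symm.measurable
      ((F.measurableSet_occurring_resample S.1 S.2 hB).prod (hr _ _))

/-- The successive assignments of resampling have weighted laws. -/
theorem Extremal.measurable_and_isWeighted_map [Fintype ι] [Finite κ] (hF : F.Extremal)
    {Ω : Type*} [MeasurableSpace Ω] {P : Measure Ω} [IsProbabilityMeasure P]
    {x : ℕ → Ω → ∀ i, D i} {c : ℕ → Ω → C} (hx : ∀ t, Measurable (x t))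
    (hc : ∀ t, Measurable (c t)) (hmap : ∀ t, P.map (x t) = F.prod)
    (hxc : ∀ t, IndepFun (x t) (c t) P) (hind : iIndepFun (fun t ω => (x t ω, c t ω)) P)
    (hr : ∀ T R, MeasurableSet {c | r c T = R}) (hrT : ∀ c T, r c T ⊆ T)
    {Y : ℕ → Ω → ∀ i, D i} (hY₀ : ∀ ω, Y 0 ω = x 0 ω)
    (hY : ∀ t ω, Y (t + 1) ω = F.step r (Y t ω) (x (t + 1) ω, c (t + 1) ω)) (t : ℕ) :
    Measurable (Y t) ∧ F.IsWeighted (P.map (Y t)) := by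
  have hz (t) : Measurable fun ω => (x t ω, c t ω) := (hx t).prodMk (hc t)
  have h := indepFun_recursion hz hind measurable_fst (F.measurable_step hr) hY₀ hY
  refine ⟨(h t).1, ?_⟩
  induction t with
  | zero =>
    rw [show Y 0 = x 0 from funext hY₀, hmap]
    exact F.isWeighted_prod
  | succ t ih =>
    obtain ⟨hm, hi⟩ := h t
    have := Measure.isProbabilityMeasure_map hm.aemeasurable (μ := P)
    have := Measure.isProbabilityMeasure_map (hc (t + 1)).aemeasurable (μ := P)
    have h1 := ih.map_step hF (P.map (c (t + 1))) hr hrT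
    -- By independence of state, draw and selection, the product measure in `h1` is their joint law.
    rw [← hmap (t + 1), ← (hxc (t + 1)).map_prod_eq_prod_map_map (hx _).aemeasurable
      (hc _).aemeasurable, ← hi.map_prod_eq_prod_map_map hm.aemeasurable (hz _).aemeasurable,
      Measure.map_map (F.measurable_step hr) (hm.prodMk (hz _))] at h1
    rwa [show Y (t + 1) = _ from funext (hY t)]

end Step

variable {F}

/-- A process that stops at good assignments and has weighted laws outputs the product
distribution conditioned on the good assignments. -/
theorem hasLaw_output_of_isWeighted [Fintype ι] [Finite κ]
    {Ω : Type*} [MeasurableSpace Ω] {P : Measure Ω} [IsProbabilityMeasure P]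
    {Y : ℕ → Ω → ∀ i, D i} (hm : ∀ t, Measurable (Y t)) (hw : ∀ t, F.IsWeighted (P.map (Y t)))
    (hfix : ∀ t ω, Y t ω ∈ F.good → Y (t + 1) ω = Y t ω)
    (hpos : P {ω | F.Halts fun t => Y t ω} ≠ 0) :
    F.prod F.good ≠ 0 ∧
      HasLaw (fun ω => F.output fun t => Y t ω) F.prod[|F.good]
        P[|{ω | F.Halts fun t => Y t ω}] := by
  have hgood := F.measurableSet_good
  have hstay {ω t} (h : Y t ω ∈ F.good) {s} (hs : t ≤ s) : Y s ω = Y t ω := by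
    induction s, hs using Nat.le_induction with
    | base => rfl
    | succ s _ ih => rw [hfix s ω (ih ▸ h), ih]
  have hout {ω t} (h : Y t ω ∈ F.good) : F.output (fun t => Y t ω) = Y t ω :=
    (hstay (Nat.sInf_mem (⟨t, h⟩ : {t | Y t ω ∈ F.good}.Nonempty)) (Nat.sInf_le h)).symm
  have hset (B : Set (∀ i, D i)) :
      {ω | F.Halts fun t => Y t ω} ∩ (fun ω => F.output fun t => Y t ω) ⁻¹' B =
        ⋃ t, Y t ⁻¹' (F.good ∩ B) := by
    ext ω
    simp only [Set.mem_inter_iff, Set.mem_iUnion, Set.mem_preimage, Set.mem_ofPred_eq, Halts]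
    constructor
    · rintro ⟨⟨t, ht⟩, hB⟩
      exact ⟨t, ht, hout ht ▸ hB⟩
    · rintro ⟨t, ht, hB⟩
      exact ⟨⟨t, ht⟩, (hout ht).symm ▸ hB⟩
  have hset' : {ω | F.Halts fun t => Y t ω} = ⋃ t, Y t ⁻¹' F.good := by
    simpa using hset Set.univ
  have hHm : MeasurableSet {ω | F.Halts fun t => Y t ω} :=
    hset' ▸ MeasurableSet.iUnion fun t => hm t hgood
  -- `a t` is the density of the part halted by time `t`; the output has density `⨆ t, a t` on
  -- `good`, a constant that normalization removes.
  choose a ha using fun t => hw t ∅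
  have hP {B} (hB : MeasurableSet B) :
      P ({ω | F.Halts fun t => Y t ω} ∩ (fun ω => F.output fun t => Y t ω) ⁻¹' B) =
        (⨆ t, a t) * F.prod (F.good ∩ B) := by
    rw [hset, Monotone.measure_iUnion, ENNReal.iSup_mul]
    · refine iSup_congr fun t => ?_
      rw [← Measure.map_apply (hm t) (hgood.inter hB), ha t _ (hgood.inter hB) fun σ hσ => hσ.1]
    · rintro s t hst ω ⟨h1, h2⟩
      rw [Set.mem_preimage, hstay h1 hst]
      exact ⟨h1, h2⟩
  have hPH : P {ω | F.Halts fun t => Y t ω} = (⨆ t, a t) * F.prod F.good := by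
    simpa using hP MeasurableSet.univ
  have ha0 : (⨆ t, a t) ≠ 0 := left_ne_zero_of_mul (hPH ▸ hpos)
  have hg0 : F.prod F.good ≠ 0 := right_ne_zero_of_mul (hPH ▸ hpos)
  have hatop : (⨆ t, a t) ≠ ⊤ := fun h => by
    rw [h, ENNReal.top_mul hg0] at hPH
    exact measure_ne_top _ _ hPH
  have hmo : Measurable fun ω => F.output fun t => Y t ω := by
    intro B hB
    rw [← Set.inter_union_compl ((fun ω => F.output fun t => Y t ω) ⁻¹' B)
      {ω | F.Halts fun t => Y t ω}, Set.inter_comm, hset]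
    refine (MeasurableSet.iUnion fun t => hm t (hgood.inter hB)).union ?_
    convert! (hm 0 hB).inter hHm.compl using 1
    ext ω
    refine and_congr_left fun h => ?_
    -- Without halting, `sInf ∅ = 0` makes the output `Y 0 ω`.
    have : {t | Y t ω ∈ F.good} = ∅ := Set.eq_empty_of_forall_notMem fun t ht => h ⟨t, ht⟩
    simp [output, this]
  refine ⟨hg0, hmo.aemeasurable, ?_⟩
  ext B hB
  rw [Measure.map_apply hmo hB, cond_apply hHm, cond_apply hgood, hP hB, hPH,
    ENNReal.mul_inv (Or.inl ha0) (Or.inl hatop), mul_mul_mul_comm,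
    ENNReal.inv_mul_cancel ha0 hatop, one_mul]

theorem Extremal.hasLaw_output_parallelRun [Fintype ι] [Finite κ] (hF : F.Extremal)
    {Ω : Type*} [MeasurableSpace Ω] {P : Measure Ω} [IsProbabilityMeasure P]
    {x : ℕ → Ω → ∀ i, D i} (hx : FreshDraws F P x)
    (hpos : P {ω | F.Halts (F.parallelRun fun t => x t ω)} ≠ 0) :
    F.prod F.good ≠ 0 ∧
      HasLaw (fun ω => F.output (F.parallelRun fun t => x t ω)) F.prod[|F.good]
        P[|{ω | F.Halts (F.parallelRun fun t => x t ω)}] := by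
  have h := hF.measurable_and_isWeighted_map (C := Unit) (r := fun _ T => T)
    (c := fun _ _ => ()) hx.measurable (fun _ => measurable_const) hx.map_eq
    (fun _ => indepFun_const_right _ _)
    (hx.indep.comp (fun _ y => (y, ())) fun _ => measurable_prodMk_right)
    (fun _ _ => MeasurableSet.of_discrete) (fun _ _ => subset_rfl)
    (Y := fun t ω => F.parallelRun (fun t => x t ω) t) (fun _ => rfl) (fun _ _ => rfl)
  refine hasLaw_output_of_isWeighted (fun t => (h t).1) (fun t => (h t).2) (fun t ω hg => ?_) hpos
  rw [parallelRun, show F.occurring _ = ∅ from hg]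
  simp [resample_empty]

theorem Extremal.hasLaw_output_sequentialRun [Fintype ι] [Finite κ] [MeasurableSpace κ]
    [DiscreteMeasurableSpace κ] (hF : F.Extremal)
    {Ω : Type*} [MeasurableSpace Ω] {P : Measure Ω} [IsProbabilityMeasure P]
    {x : ℕ → Ω → ∀ i, D i} {c : ℕ → Ω → Picker κ} (hx : FreshDrawsAndPicks F P x c)
    (hpos : P {ω | F.Halts (F.sequentialRun (fun t => x t ω) (fun t => c t ω))} ≠ 0) :
    F.prod F.good ≠ 0 ∧
      HasLaw (fun ω => F.output (F.sequentialRun (fun t => x t ω) (fun t => c t ω)))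
        F.prod[|F.good]
        P[|{ω | F.Halts (F.sequentialRun (fun t => x t ω) (fun t => c t ω))}] := by
  classical
  have h := hF.measurable_and_isWeighted_map (C := Picker κ)
    -- With no occurring event the selection is empty and the step is the identity, as after
    -- halting.
    (r := fun c T => if h : T.Nonempty then {(c ⟨T, h⟩).1} else ∅)
    hx.measurable_draw hx.measurable_pick hx.map_eq hx.indep_draw_pick hx.indep
    (fun T R => ?_) (fun c T => ?_)
    (Y := fun t ω => F.sequentialRun (fun t => x t ω) (fun t => c t ω) t)
    (fun _ => rfl) (fun t ω => ?_)
  · refine hasLaw_output_of_isWeighted (fun t => (h t).1) (fun t => (h t).2)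
      (fun t ω hg => ?_) hpos
    rw [sequentialRun, dif_neg]
    rw [show F.occurring _ = ∅ from hg]
    exact Set.not_nonempty_empty
  · by_cases hT : T.Nonempty
    · simp only [dif_pos hT]
      have hm : Measurable fun c : Picker κ => c ⟨T, hT⟩ := measurable_pi_apply _
      exact hm (MeasurableSet.of_discrete (s := {k | {k.1} = R}))
    · simp [hT]
  · by_cases hT : T.Nonempty
    · simp [dif_pos hT]
    · simp [dif_neg hT]
  · by_cases hT : (F.occurring (F.sequentialRun (fun t => x t ω) (fun t => c t ω) t)).Nonempty
    · simp only [sequentialRun, step, vars, dif_pos hT, Set.mem_singleton_iff,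
        Set.iUnion_iUnion_eq_left]
    · simp [sequentialRun, step, vars, dif_neg hT, resample_empty]

end Framework

/-- Conditioning a product of uniform distributions yields uniform distributions. -/
theorem pi_uniformOn_univ_cond {ι : Type*} [Fintype ι] {D : ι → Type*}
    [∀ i, MeasurableSpace (D i)] [∀ i, MeasurableSingletonClass (D i)] [∀ i, Finite (D i)]
    [∀ i, Nonempty (D i)] (S : Set (∀ i, D i)) :
    (Measure.pi fun i => uniformOn (Set.univ : Set (D i)))[|S] = uniformOn S := by
  classical
  have := fun i => Fintype.ofFinite (D i)
  have h : (Measure.pi fun i => uniformOn (Set.univ : Set (D i))) =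
      (∏ i, (Fintype.card (D i) : ENNReal)⁻¹) • Measure.count := by
    refine Measure.ext_of_singleton fun σ => ?_
    rw [Measure.pi_singleton]
    simp [uniformOn_univ]
  have h0 : (∏ i, (Fintype.card (D i) : ENNReal)⁻¹) ≠ 0 :=
    Finset.prod_ne_zero_iff.2 fun i _ => by simp
  have htop : (∏ i, (Fintype.card (D i) : ENNReal)⁻¹) ≠ ⊤ :=
    ENNReal.prod_ne_top fun i _ => by simp
  -- A nonzero finite multiple of counting measure has the same conditional measures as counting
  -- measure.
  rw [h, uniformOn, ProbabilityTheory.cond, ProbabilityTheory.cond, Measure.restrict_smul, smul_smul,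
    Measure.smul_apply, smul_eq_mul,
    ENNReal.mul_inv (Or.inl h0) (Or.inl htop), mul_right_comm, ENNReal.inv_mul_cancel h0 htop,
    one_mul]

/-! ### Sink popping -/

section Sink

variable {V : Type u} [Finite V] (G : SimpleGraph V)

/-- A common edge of two vertices cannot point towards both. -/
theorem extremal_sinkFramework [Fintype G.edgeSet] : (sinkFramework G).Extremal := by
  rintro a b ⟨hab, e, ha, hb⟩
  have : (sinkFramework G).bad a ∩ (sinkFramework G).bad b = ∅ :=
    Set.eq_empty_of_forall_notMem fun σ hσ => hab ((hσ.1 e ha).symm.trans (hσ.2 e hb))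
  rw [this, measure_empty]

theorem good_sinkFramework : (sinkFramework G).good = {σ | ∀ a, ¬ IsSink σ a} :=
  Set.ext fun _ => Set.eq_empty_iff_forall_notMem

theorem parallelRun_sinkFramework (x : ℕ → Orientation G) :
    (sinkFramework G).parallelRun x = sinkPopping x := by
  classical
  funext t
  induction t with
  | zero => rfl
  | succ t ih =>
    funext e
    rw [Framework.parallelRun, sinkPopping, ih, resample]
    refine if_congr ?_ rfl rfl
    simp only [Set.mem_iUnion, exists_prop]
    exact exists_congr fun a => and_comm

theorem prod_cond_sinkFramework [Fintype G.edgeSet] (S : Set (Orientation G)) :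
    (sinkFramework G).prod[|S] = uniformOn S :=
  have (e : G.edgeSet) : MeasurableSingletonClass (EdgeOrientation G e) := ⟨fun _ => trivial⟩
  pi_uniformOn_univ_cond S

end Sink

/-! ### Cycle popping -/

section Cycle

variable {V : Type u} {G : SimpleGraph V} {r : V}

theorem next_root (s : Arrows G r) : next s r = r := dif_pos rfl

theorem next_of_ne (s : Arrows G r) {a : V} (h : a ≠ r) : next s a = (s ⟨a, h⟩).1 := dif_neg h

theorem adj_next (s : Arrows G r) {a : V} (h : a ≠ r) : G.Adj a (next s a) := by
  rw [next_of_ne s h]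
  exact (s ⟨a, h⟩).2

theorem iterate_next_root (s : Arrows G r) (n : ℕ) : (next s)^[n] r = r :=
  Function.iterate_fixed (next_root s) n

theorem iterate_next_ne_root (s : Arrows G r) {a : V} (ha : a ∈ Function.periodicPts (next s))
    (har : a ≠ r) (n : ℕ) : (next s)^[n] a ≠ r := by
  intro h
  obtain ⟨m, hm, hp⟩ := ha
  refine har ?_
  -- `m * n` is a multiple of the period `m` that is at least `n`: a walk that has reached `r` would
  -- have to return to `a`.
  have h1 : (next s)^[m * n] a = a := (hp.mul_const n)
  have h2 : (next s)^[(m * n - n) + n] a = r := by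
    rw [Function.iterate_add_apply, h, iterate_next_root]
  rwa [Nat.sub_add_cancel (Nat.le_mul_of_pos_left n hm), h1] at h2

/-- All arrows of the directed cycle `p` are present. -/
def HasCycle (s : Arrows G r) (p : DirectedCycle G r) : Prop := ∀ a, p.1 a ≠ a → next s a = p.1 a

theorem DirectedCycle.ne_root (p : DirectedCycle G r) {a : V} (h : p.1 a ≠ a) : a ≠ r :=
  fun e => h (e ▸ p.2.2.1)

theorem HasCycle.iterate_next {s : Arrows G r} {p : DirectedCycle G r} (h : HasCycle s p) {a : V}
    (ha : p.1 a ≠ a) (n : ℕ) : (next s)^[n] a = (p.1 ^ n) a := by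
  induction n with
  | zero => rfl
  | succ n ih =>
    rw [Function.iterate_succ_apply', ih, pow_succ', Equiv.Perm.mul_apply]
    exact h _ fun e => ha ((p.1 ^ n).injective (by
      rwa [← Equiv.Perm.mul_apply, ← pow_succ, pow_succ', Equiv.Perm.mul_apply]))

/-- Every periodic vertex other than the root lies on a directed cycle. -/
theorem exists_hasCycle {s : Arrows G r} {a : V} (ha : a ∈ Function.periodicPts (next s))
    (har : a ≠ r) : ∃ p : DirectedCycle G r, HasCycle s p ∧ p.1 a ≠ a := by
  classical
  -- `next s` permutes its periodic points; extended by the identity it becomes a permutation of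
  -- `V`, whose cycle through `a` is the required one.
  set q : Equiv.Perm V :=
    Equiv.Perm.ofSubtype ((Function.bijOn_periodicPts (f := next s)).equiv (next s)) with hq
  have hqn {b} (hb : b ∈ Function.periodicPts (next s)) : q b = next s b :=
    Equiv.Perm.ofSubtype_apply_of_mem _ hb
  have hq' {b} (hb : q b ≠ b) : b ≠ r ∧ q b = next s b := by
    have h1 : b ∈ Function.periodicPts (next s) := by
      by_contra h
      exact hb (Equiv.Perm.ofSubtype_apply_of_not_mem _ h)
    refine ⟨?_, hqn h1⟩
    rintro rfl
    exact hb ((hqn h1).trans (next_root s))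
  have hqa : q a ≠ a := by
    rw [hqn ha]
    exact (adj_next s har).ne'
  have hc {b} (hb : q.cycleOf a b ≠ b) : b ≠ r ∧ q.cycleOf a b = next s b := by
    rw [Equiv.Perm.cycleOf_apply] at hb ⊢
    split_ifs at hb ⊢ with h
    · exact hq' hb
    · exact absurd rfl hb
  refine ⟨⟨q.cycleOf a, q.isCycle_cycleOf hqa, ?_, fun b hb => ?_⟩, fun b hb => (hc hb).2.symm, ?_⟩
  · by_contra h
    exact (hc h).1 rfl
  · rw [(hc hb).2]
    exact adj_next s (hc hb).1
  · rwa [Equiv.Perm.cycleOf_apply_self]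

variable [Finite V]

/-- Both cycles consist of the orbit of the common vertex `a` under `next s`, on which both act as
`next s`. -/
theorem HasCycle.eq {s : Arrows G r} {p q : DirectedCycle G r} (hp : HasCycle s p)
    (hq : HasCycle s q) {a : V} (hpa : p.1 a ≠ a) (hqa : q.1 a ≠ a) : p = q := by
  have hpq (n : ℕ) : (p.1 ^ n) a = (q.1 ^ n) a := by
    rw [← hp.iterate_next hpa, hq.iterate_next hqa]
  have key {p q : DirectedCycle G r} (hp : HasCycle s p) (hq : HasCycle s q)
      (hpa : p.1 a ≠ a) (hqa : q.1 a ≠ a) {b} (hb : p.1 b ≠ b) : p.1 b = q.1 b := by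
    obtain ⟨n, hn⟩ := p.2.1.exists_pow_eq hpa hb
    rw [← hn, ← Equiv.Perm.mul_apply, ← pow_succ', ← hp.iterate_next hpa, hq.iterate_next hqa,
      ← hp.iterate_next hpa, hq.iterate_next hqa, pow_succ', Equiv.Perm.mul_apply]
  refine Subtype.ext (Equiv.ext fun b => ?_)
  by_cases h1 : p.1 b = b
  · by_cases h2 : q.1 b = b
    · rw [h1, h2]
    · exact (key hq hp hqa hpa h2).symm
  · exact key hp hq hpa hqa h1

theorem HasCycle.mem_periodicPts {s : Arrows G r} {p : DirectedCycle G r} (h : HasCycle s p)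
    {a : V} (ha : p.1 a ≠ a) : a ∈ Function.periodicPts (next s) := by
  refine ⟨orderOf p.1, orderOf_pos _, ?_⟩
  rw [Function.IsPeriodicPt, Function.IsFixedPt, h.iterate_next ha, pow_orderOf_eq_one]
  rfl

variable (G r) in
theorem mem_bad_cycleFramework (h : ∀ a, a ≠ r → ∃ b, G.Adj a b) (p : DirectedCycle G r)
    (s : Arrows G r) : s ∈ (cycleFramework G r h).bad p ↔ HasCycle s p := by
  constructor
  · intro hs a ha
    rw [next_of_ne s (p.ne_root ha)]
    exact hs ⟨a, p.ne_root ha⟩ ha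
  · intro hs a ha
    rw [← next_of_ne s a.2]
    exact hs a.1 ha

variable (h : ∀ a, a ≠ r → ∃ b, G.Adj a b)

theorem extremal_cycleFramework [Fintype {a : V // a ≠ r}] : (cycleFramework G r h).Extremal := by
  rintro p q ⟨hpq, a, ha, hb⟩
  have : (cycleFramework G r h).bad p ∩ (cycleFramework G r h).bad q = ∅ :=
    Set.eq_empty_of_forall_notMem fun s hs => hpq
      (((mem_bad_cycleFramework G r h p s).1 hs.1).eq
        ((mem_bad_cycleFramework G r h q s).1 hs.2) ha hb)
  rw [this, measure_empty]

/-- A walk on finitely many vertices revisits one; unless that vertex is `r`, it lies on a directed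
cycle. Conversely, a walk on a cycle avoiding `r` never reaches `r`. -/
theorem good_cycleFramework : (cycleFramework G r h).good = {s | IsRootedTree s} := by
  ext s
  have h1 : s ∈ (cycleFramework G r h).good ↔ ∀ p, ¬ HasCycle s p :=
    Set.eq_empty_iff_forall_notMem.trans
      (forall_congr' fun p => not_congr (mem_bad_cycleFramework G r h p s))
  rw [h1]
  constructor
  · intro hs a
    obtain ⟨m, n, hmn, he⟩ := Finite.exists_ne_map_eq_of_infinite fun n => (next s)^[n] a
    wlog hlt : m < n generalizing m n
    · exact this n m hmn.symm he.symm (by omega)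
    refine ⟨m, by_contra fun hr => ?_⟩
    have hper : (next s)^[m] a ∈ Function.periodicPts (next s) := by
      refine ⟨n - m, by omega, ?_⟩
      rw [Function.IsPeriodicPt, Function.IsFixedPt, ← Function.iterate_add_apply,
        Nat.sub_add_cancel hlt.le]
      exact he.symm
    obtain ⟨p, hp, -⟩ := exists_hasCycle hper hr
    exact hs p hp
  · intro hs p hp
    obtain ⟨a, ha, -⟩ := p.2.1
    obtain ⟨n, hn⟩ := hs a
    exact iterate_next_ne_root s (hp.mem_periodicPts ha) (p.ne_root ha) n hn

theorem parallelRun_cycleFramework (x : ℕ → Arrows G r) :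
    (cycleFramework G r h).parallelRun x = cyclePopping x := by
  classical
  funext t
  induction t with
  | zero => rfl
  | succ t ih =>
    funext a
    rw [Framework.parallelRun, cyclePopping, ih, resample]
    refine if_congr ?_ rfl rfl
    simp only [Set.mem_iUnion, exists_prop]
    -- The vertices on occurring cycles are exactly the periodic points other than `r`.
    constructor
    · rintro ⟨p, hp, ha⟩
      exact ((mem_bad_cycleFramework G r h p _).1 hp).mem_periodicPts ha
    · intro ha
      obtain ⟨p, hp, hpa⟩ := exists_hasCycle ha a.2
      exact ⟨p, (mem_bad_cycleFramework G r h p _).2 hp, hpa⟩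

theorem prod_cond_cycleFramework [Fintype {a : V // a ≠ r}] (S : Set (Arrows G r)) :
    (cycleFramework G r h).prod[|S] = uniformOn S :=
  have (a : {a : V // a ≠ r}) : MeasurableSingletonClass (Arrow G a.1) := ⟨fun _ => trivial⟩
  have (a : {a : V // a ≠ r}) : Nonempty (Arrow G a.1) :=
    (h a.1 a.2).elim fun b hb => ⟨⟨b, hb⟩⟩
  pi_uniformOn_univ_cond S

end Cycle

end PRS

end

theorem mainTheorem2 :
    -- extremal instances: parallel and sequential resampling
    (∀ {ι : Type u} {κ : Type v} {D : ι → Type w} [∀ i, MeasurableSpace (D i)]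
      [Fintype ι] [Finite κ] (F : PRS.Framework ι κ D), F.Extremal →
      ∀ {Ω : Type z} [MeasurableSpace Ω] (P : Measure Ω) [IsProbabilityMeasure P],
        (∀ x : ℕ → Ω → ∀ i, D i, PRS.FreshDraws F P x →
          P {ω | F.Halts (F.parallelRun fun t => x t ω)} ≠ 0 →
          F.prod F.good ≠ 0 ∧
          HasLaw (fun ω => F.output (F.parallelRun fun t => x t ω)) F.prod[|F.good]
            P[|{ω | F.Halts (F.parallelRun fun t => x t ω)}]) ∧
        (∀ [MeasurableSpace κ] [DiscreteMeasurableSpace κ]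
          (x : ℕ → Ω → ∀ i, D i) (c : ℕ → Ω → PRS.Picker κ), PRS.FreshDrawsAndPicks F P x c →
          P {ω | F.Halts (F.sequentialRun (fun t => x t ω) (fun t => c t ω))} ≠ 0 →
          F.prod F.good ≠ 0 ∧
          HasLaw (fun ω => F.output (F.sequentialRun (fun t => x t ω) (fun t => c t ω)))
            F.prod[|F.good]
            P[|{ω | F.Halts (F.sequentialRun (fun t => x t ω) (fun t => c t ω))}])) ∧
    -- sink popping
    (∀ {V : Type u} [Finite V] (G : SimpleGraph V) [Fintype G.edgeSet],
      (PRS.sinkFramework G).Extremal ∧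
      (PRS.sinkFramework G).good = {σ | ∀ a, ¬ PRS.IsSink σ a} ∧
      (∀ x : ℕ → PRS.Orientation G, (PRS.sinkFramework G).parallelRun x = PRS.sinkPopping x) ∧
      ∀ {Ω : Type z} [MeasurableSpace Ω] (P : Measure Ω) [IsProbabilityMeasure P]
        (x : ℕ → Ω → PRS.Orientation G), PRS.FreshDraws (PRS.sinkFramework G) P x →
        P {ω | (PRS.sinkFramework G).Halts (PRS.sinkPopping fun t => x t ω)} ≠ 0 →
        HasLaw (fun ω => (PRS.sinkFramework G).output (PRS.sinkPopping fun t => x t ω))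
          (uniformOn {σ : PRS.Orientation G | ∀ a, ¬ PRS.IsSink σ a})
          P[|{ω | (PRS.sinkFramework G).Halts (PRS.sinkPopping fun t => x t ω)}]) ∧
    -- cycle popping
    (∀ {V : Type u} [Finite V] (G : SimpleGraph V) (r : V) [Fintype {a : V // a ≠ r}]
      (h : ∀ a, a ≠ r → ∃ b, G.Adj a b),
      (PRS.cycleFramework G r h).Extremal ∧
      (PRS.cycleFramework G r h).good = {s | PRS.IsRootedTree s} ∧
      (∀ x : ℕ → PRS.Arrows G r,
        (PRS.cycleFramework G r h).parallelRun x = PRS.cyclePopping x) ∧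
      ∀ {Ω : Type z} [MeasurableSpace Ω] (P : Measure Ω) [IsProbabilityMeasure P]
        (x : ℕ → Ω → PRS.Arrows G r), PRS.FreshDraws (PRS.cycleFramework G r h) P x →
        P {ω | (PRS.cycleFramework G r h).Halts (PRS.cyclePopping fun t => x t ω)} ≠ 0 →
        HasLaw (fun ω => (PRS.cycleFramework G r h).output (PRS.cyclePopping fun t => x t ω))
          (uniformOn {s : PRS.Arrows G r | PRS.IsRootedTree s})
          P[|{ω | (PRS.cycleFramework G r h).Halts (PRS.cyclePopping fun t => x t ω)}]) := by

  refine ⟨fun F hF Ω _ P _ => ⟨fun x hx => hF.hasLaw_output_parallelRun hx,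
    fun x c hx => hF.hasLaw_output_sequentialRun hx⟩, ?_, ?_⟩
  · intro V _ G _
    refine ⟨PRS.extremal_sinkFramework G, PRS.good_sinkFramework G,
      PRS.parallelRun_sinkFramework G, fun P _ x hx hpos => ?_⟩
    simp only [← PRS.parallelRun_sinkFramework] at hpos ⊢
    rw [← PRS.prod_cond_sinkFramework, ← PRS.good_sinkFramework]
    exact ((PRS.extremal_sinkFramework G).hasLaw_output_parallelRun hx hpos).2
  · intro V _ G r _ h
    refine ⟨PRS.extremal_cycleFramework h, PRS.good_cycleFramework h,
      PRS.parallelRun_cycleFramework h, fun P _ x hx hpos => ?_⟩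
    have : Finite (PRS.DirectedCycle G r) :=
      inferInstanceAs (Finite {p : Equiv.Perm V // _})
    simp only [← PRS.parallelRun_cycleFramework h] at hpos ⊢
    rw [← PRS.prod_cond_cycleFramework h, ← PRS.good_cycleFramework h]
    exact ((PRS.extremal_cycleFramework h).hasLaw_output_parallelRun hx hpos).2
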